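/- Let $G$ be a topological group (not assumed Hausdorff). The left (respectively right) uniformity of $G$ is the one with basic entourages $\{(g,h)\in G\times G: g^{-1}h\in V\}$ (respectively $\{(g,h)\in G\times G: gh^{-1}\in V\}$), where $V$ runs over the neighbourhoods of the identity. Call a subset $A\subset G$ precompact if it is totally bounded with respect to both the left and the right uniformity of $G$. Suppose that $G$ is functionally generated by the collection of its precompact subsets, that is, for every discontinuous function $f:G\to\mathbb R$ there is a precompact set $A\subset G$ such that the restriction $f_{|A}:A\to\mathbb R$ has no continuous extension to $G$. Then $G$ is proximally fine, that is: for every uniform space $Y$ and every map $f:G\to Y$ such that $\varphi\circ f:G\to\mathbb R$ is uniformly continuous with respect to the right uniformity of $G$ for every bounded uniformly continuous function $\varphi:Y\to\mathbb R$, the map $f$ is uniformly continuous with respect to the right uniformity of $G$. -/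

import Mathlib

universe u v

/-- A map `f` between uniform spaces is proximally continuous if `φ ∘ f` is uniformly continuous
for every bounded uniformly continuous function `φ : Y → ℝ`. -/
def ProximallyContinuous {X : Type u} {Y : Type v} [UniformSpace X] [UniformSpace Y]
    (f : X → Y) : Prop :=
  ∀ φ : Y → ℝ, UniformContinuous φ → (∃ C : ℝ, ∀ y, |φ y| ≤ C) → UniformContinuous (φ ∘ f)

/-- A uniform space `X` is proximally fine if every proximally continuous map from `X` to a
uniform space is uniformly continuous. The universe `v` of the target spaces is arbitrary. -/
def ProximallyFine (X : Type u) [UniformSpace X] : Prop :=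
  ∀ (Y : Type v) [UniformSpace Y] (f : X → Y), ProximallyContinuous f → UniformContinuous f

/-- A topological group is proximally fine if it is so for its right uniformity, whose basic
entourages are the sets of `(g, h)` with `h * g⁻¹ ∈ V`, for `V` a neighbourhood of `1`. -/
def ProximallyFineGroup (G : Type u) [Group G] [TopologicalSpace G] [IsTopologicalGroup G] :
    Prop :=
  @ProximallyFine.{u, v} G (IsTopologicalGroup.rightUniformSpace G)

/-- A subset of a topological group is precompact if it is totally bounded both for the left and
for the right uniformity of the group. -/
def GroupPrecompact {G : Type u} [Group G] [TopologicalSpace G] [IsTopologicalGroup G]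
    (A : Set G) : Prop :=
  @TotallyBounded G (IsTopologicalGroup.leftUniformSpace G) A ∧
    @TotallyBounded G (IsTopologicalGroup.rightUniformSpace G) A

/-- A topological space `X` is functionally generated by a collection `M` of subsets if for every
discontinuous `f : X → ℝ` there is `A ∈ M` such that the restriction of `f` to `A` has no
continuous extension to `X`. -/
def FunctionallyGenerated {X : Type u} [TopologicalSpace X] (M : Set (Set X)) : Prop :=
  ∀ f : X → ℝ, ¬ Continuous f →
    ∃ A ∈ M, ¬ ∃ g : X → ℝ, Continuous g ∧ Set.EqOn g f A

open Filter Set Topology Uniformity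

/-! For pseudometric `Y`, put δ(v) = sup_g min(d(f g, f(v g)), 1). Since δ(1) = 0, continuity of δ
at 1 makes f right uniformly continuous. By functional generation it suffices that δ agrees with a
continuous function on each precompact A, and uniform continuity of δ on A ensures this. Up to
truncation, |δ(b) - δ(a)| is bounded by the displacements of f under b a⁻¹ and a b⁻¹, which lie in
the totally bounded set A A⁻¹.

The core is `ProximallyContinuous.exists_nhds_forall_dist_lt`: small elements of a totally bounded
set displace f little. Otherwise Efremovich's lemma yields S ⊆ `Y` whose truncated distance
function, composed with f, is not uniformly continuous. A general `Y` is treated one entourage at a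
time, through a coarser pseudometric. -/

/-! ### Coarser pseudometrics and continuous extension -/

/-- Countably many entourages are entourages for a single coarser pseudometric. -/
theorem exists_pseudoMetricSpace_le_of_mem_uniformity {X : Type*} [u : UniformSpace X]
    (s : ℕ → Set (X × X)) (hs : ∀ n, s n ∈ 𝓤 X) :
    ∃ d : PseudoMetricSpace X, u ≤ d.toUniformSpace ∧ ∀ n, s n ∈ 𝓤[d.toUniformSpace] := by
  have step : ∀ (n : ℕ) (t : {t : Set (X × X) // t ∈ 𝓤 X}), ∃ t' : {t : Set (X × X) // t ∈ 𝓤 X},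
      t'.1 ⊆ s n ∧ (∀ a b, (a, b) ∈ t'.1 → (b, a) ∈ t'.1) ∧
      ∀ a b c, (a, b) ∈ t'.1 → (b, c) ∈ t'.1 → (a, c) ∈ t.1 := by
    rintro n ⟨t, ht⟩
    obtain ⟨w, hw, hsymm, hcomp⟩ := comp_symm_mem_uniformity_sets (inter_mem (hs n) ht)
    have sub : w ⊆ s n ∩ t := fun p hp => hcomp ⟨p.1, refl_mem_uniformity hw, hp⟩
    exact ⟨⟨w, hw⟩, fun p hp => (sub hp).1, fun a b h => hsymm.symm _ _ h,
      fun a b c h h' => (hcomp ⟨b, h, h'⟩ : (a, c) ∈ s n ∩ t).2⟩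
  choose F hFs hFsymm hFcomp using step
  let t : ℕ → {t : Set (X × X) // t ∈ 𝓤 X} := fun n =>
    Nat.rec ⟨univ, univ_mem⟩ (fun n t => F n t) n
  have t_succ : ∀ n, t (n + 1) = F n (t n) := fun n => rfl
  have anti : Antitone fun n => (t n).1 := by
    refine antitone_nat_of_succ_le fun n p hp => ?_
    rw [t_succ] at hp
    exact hFcomp n (t n) p.1 p.2 p.2 hp (refl_mem_uniformity (F n (t n)).2)
  have basis : (⨅ n, 𝓟 (t n).1).HasBasis (fun _ => True) (fun n => (t n).1) :=
    hasBasis_iInf_principal anti.directed_ge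
  let u' : UniformSpace X := UniformSpace.ofCore
    { uniformity := ⨅ n, 𝓟 (t n).1
      refl := by
        refine le_iInf fun n => ?_
        rw [principal_mono]
        rintro ⟨a, b⟩ h
        obtain rfl : a = b := h
        exact refl_mem_uniformity (t n).2
      symm := by
        refine basis.tendsto_iff basis |>.2 fun n _ => ⟨n + 1, trivial, ?_⟩
        rintro ⟨a, b⟩ h
        refine anti (Nat.le_succ n) ?_
        exact hFsymm n (t n) a b h
      comp := by
        refine (basis.lift' (monotone_id.relComp monotone_id)).le_basis_iff basis |>.2
          fun n _ => ⟨n + 1, trivial, ?_⟩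
        rintro ⟨a, b⟩ ⟨c, h, h'⟩
        exact hFcomp n (t n) a c b h h' }
  have unif : @uniformity X u' = ⨅ n, 𝓟 (t n).1 := rfl
  have : (@uniformity X u').IsCountablyGenerated := by
    rw [unif]; infer_instance
  refine ⟨@UniformSpace.pseudoMetricSpace X u' this, ?_, fun n => ?_⟩
  · exact (le_iInf fun n => le_principal_iff.2 (t n).2 : 𝓤[u] ≤ ⨅ n, 𝓟 (t n).1)
  -- The index shifts because `t 0` is `univ`: only `t (n + 1)` lies inside `s n`.
  · exact mem_of_superset (basis.mem_of_mem (i := n + 1) trivial) (hFs n (t n))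

/-- Completeness of ℝ gives an extension to the closure of `A`; Tietze's theorem, available because
pseudometric spaces are normal, gives the rest. -/
theorem UniformContinuousOn.exists_continuous_eqOn_of_pseudoMetricSpace {X : Type*}
    [PseudoMetricSpace X] {A : Set X} {f : X → ℝ} (hf : UniformContinuousOn f A) :
    ∃ g : X → ℝ, Continuous g ∧ EqOn g f A := by
  have hA : UniformContinuous (A.domRestrict f) := uniformContinuousOn_iff_restrict.1 hf
  let e : A → closure A := inclusion subset_closure
  have he : IsUniformInducing e := by
    refine ⟨?_⟩
    rw [uniformity_subtype, uniformity_subtype, comap_comap]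
    rfl
  have hde : DenseRange e := by
    rw [DenseRange, Subtype.dense_iff]
    intro x hx
    rw [← range_comp]
    simpa [e, Function.comp_def] using hx
  have hext := uniformContinuous_uniformly_extend he hde hA
  obtain ⟨g, hg⟩ := ContinuousMap.exists_restrict_eq (isClosed_closure (s := A))
    ⟨_, hext.continuous⟩
  refine ⟨g, g.continuous, fun x hx => ?_⟩
  have h1 := DFunLike.congr_fun hg ⟨x, subset_closure hx⟩
  have h2 := (he.isDenseInducing hde).extend_eq hA.continuous ⟨x, hx⟩
  exact h1.trans h2

/-- A real-valued function that is uniformly continuous on a subset of a uniform space agrees on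
that subset with a continuous function. -/
theorem UniformContinuousOn.exists_continuous_eqOn {X : Type*} [u : UniformSpace X] {A : Set X}
    {f : X → ℝ} (hf : UniformContinuousOn f A) : ∃ g : X → ℝ, Continuous g ∧ EqOn g f A := by
  have mem : ∀ n : ℕ, {p : X × X | p.1 ∈ A → p.2 ∈ A → dist (f p.1) (f p.2) < 1 / ((n : ℝ) + 1)}
      ∈ 𝓤 X := fun n => by
    have := hf (Metric.dist_mem_uniformity (Nat.one_div_pos_of_nat (n := n) (α := ℝ)))
    filter_upwards [mem_inf_principal.1 this] with p hp h1 h2 using hp ⟨h1, h2⟩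
  -- `X` need not be normal, so Tietze is applied to a coarser pseudometric that still makes `f`
  -- uniformly continuous on `A`.
  obtain ⟨d, hd, hmem⟩ := exists_pseudoMetricSpace_le_of_mem_uniformity _ mem
  have hfd : @UniformContinuousOn X ℝ d.toUniformSpace _ f A := by
    intro r hr
    obtain ⟨ε, hε, hr⟩ := Metric.mem_uniformity_dist.1 hr
    obtain ⟨n, hn⟩ := exists_nat_one_div_lt hε
    refine mem_map.2 (mem_inf_principal.2 (mem_of_superset (hmem n) fun p hp h => ?_))
    exact hr ((hp h.1 h.2).trans hn)
  obtain ⟨g, hg, heq⟩ :=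
    @UniformContinuousOn.exists_continuous_eqOn_of_pseudoMetricSpace X d A f hfd
  exact ⟨g, continuous_le_dom (UniformSpace.toTopologicalSpace_mono hd) hg, heq⟩

/-! ### Separating pairs of points -/

/-- **Efremovich's lemma**: from pairs of points at distance at least `ε` one can extract
infinitely many such that the first points are uniformly apart from the second points. -/
theorem exists_infinite_forall_le_dist {Y : Type*} [PseudoMetricSpace Y] {x y : ℕ → Y} {ε : ℝ}
    (hε : 0 < ε) (h : ∀ n, ε ≤ dist (x n) (y n)) :
    ∃ I : Set ℕ, I.Infinite ∧ ∀ n ∈ I, ∀ m ∈ I, ε / 4 ≤ dist (x n) (y m) := by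
  by_cases h1 : ∃ n, {m | dist (x n) (y m) < ε / 4}.Infinite
  · obtain ⟨n, hn⟩ := h1
    -- The selected `y`'s are within `ε / 2` of each other, while each `x k` is `ε` away from `y k`.
    refine ⟨_, hn, fun k (hk : dist (x n) (y k) < ε / 4) m (hm : dist (x n) (y m) < ε / 4) => ?_⟩
    have := h k
    have := dist_triangle (x k) (y m) (y k)
    have := dist_triangle_left (y m) (y k) (x n)
    linarith
  by_cases h2 : ∃ n, {m | dist (x m) (y n) < ε / 4}.Infinite
  · obtain ⟨n, hn⟩ := h2
    refine ⟨_, hn, fun k (hk : dist (x k) (y n) < ε / 4) m (hm : dist (x m) (y n) < ε / 4) => ?_⟩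
    have := h m
    have := dist_triangle_left (x m) (y m) (x k)
    have := dist_triangle_right (x k) (x m) (y n)
    have := dist_comm (x k) (x m)
    linarith
  push Not at h1 h2
  -- Each index now rules out only finitely many others, so a greedy choice works.
  obtain ⟨k, -, hk⟩ := exists_seq_of_forall_finset_exists (fun _ : ℕ => True)
    (fun n m => n < m ∧ ε / 4 ≤ dist (x n) (y m) ∧ ε / 4 ≤ dist (x m) (y n)) (fun s _ => by
      have fin : (⋃ n ∈ s, (Iic n ∪ {m | dist (x n) (y m) < ε / 4} ∪
          {m | dist (x m) (y n) < ε / 4})).Finite :=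
        s.finite_toSet.biUnion fun n _ => ((finite_Iic n).union (h1 n)).union (h2 n)
      obtain ⟨m, hm⟩ := fin.exists_notMem
      refine ⟨m, trivial, fun n hn => ?_⟩
      simp only [mem_iUnion, mem_union, not_exists, not_or, mem_Iic, mem_ofPred_eq, not_lt,
        not_le] at hm
      exact ⟨(hm n hn).1.1, (hm n hn).1.2, (hm n hn).2⟩)
  have mono : StrictMono k := fun n m hnm => (hk n m hnm).1
  refine ⟨range k, infinite_range_of_injective mono.injective, ?_⟩
  rintro _ ⟨n, rfl⟩ _ ⟨m, rfl⟩
  rcases lt_trichotomy n m with hnm | rfl | hnm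
  · exact (hk n m hnm).2.1
  · linarith [h (k n)]
  · exact (hk m n hnm).2.2

/-! ### Displacement by totally bounded sets -/

section RightUniformity

variable {G : Type*} [Group G] [TopologicalSpace G] [IsTopologicalGroup G]

attribute [local instance] IsTopologicalGroup.rightUniformSpace

theorem exists_nhds_one_of_mem_uniformity_right {s : Set (G × G)} (hs : s ∈ 𝓤 G) :
    ∃ V ∈ 𝓝 (1 : G), ∀ x y : G, y * x⁻¹ ∈ V → (x, y) ∈ s := by
  obtain ⟨V, hV, h⟩ := mem_comap.1 hs
  exact ⟨V, hV, fun x y hxy => h hxy⟩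

theorem mem_uniformity_right_of_nhds_one {V : Set G} (hV : V ∈ 𝓝 (1 : G)) :
    {p : G × G | p.2 * p.1⁻¹ ∈ V} ∈ 𝓤 G :=
  preimage_mem_comap hV

theorem uniformContinuous_right_iff {Y : Type*} [PseudoMetricSpace Y] {f : G → Y} :
    UniformContinuous f ↔
      ∀ ε > 0, ∃ V ∈ 𝓝 (1 : G), ∀ v ∈ V, ∀ g, dist (f g) (f (v * g)) < ε := by
  constructor
  · intro h ε hε
    obtain ⟨V, hV, hVf⟩ := exists_nhds_one_of_mem_uniformity_right
      (h (Metric.dist_mem_uniformity hε))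
    exact ⟨V, hV, fun v hv g => hVf g (v * g) (by simpa using hv)⟩
  · intro h r hr
    obtain ⟨ε, hε, hr⟩ := Metric.mem_uniformity_dist.1 hr
    obtain ⟨V, hV, hVf⟩ := h ε hε
    refine mem_map.2 (mem_of_superset (mem_uniformity_right_of_nhds_one hV) fun p hp => hr ?_)
    simpa using hVf _ hp p.1

theorem TotallyBounded.exists_finite_right {K : Set G} (hK : TotallyBounded K) {V : Set G}
    (hV : V ∈ 𝓝 (1 : G)) : ∃ F : Set G, F.Finite ∧ ∀ x ∈ K, ∃ y ∈ F, y * x⁻¹ ∈ V := by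
  obtain ⟨F, hF, h⟩ := hK _ (mem_uniformity_right_of_nhds_one hV)
  refine ⟨F, hF, fun x hx => ?_⟩
  simpa using h hx

theorem ProximallyContinuous.continuous_right {Y : Type*} [PseudoMetricSpace Y] {f : G → Y}
    (hf : ProximallyContinuous f) : Continuous f := by
  refine continuous_iff_continuousAt.2 fun a => tendsto_iff_dist_tendsto_zero.2 ?_
  have huc : UniformContinuous fun y : Y => min (dist y (f a)) 1 :=
    ((LipschitzWith.dist_left (f a)).min_const 1).uniformContinuous
  have hc : Tendsto (fun g => min (dist (f g) (f a)) 1) (𝓝 a) (𝓝 0) := by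
    have := ((hf _ huc ⟨1, fun y => by
      rw [abs_of_nonneg (le_min dist_nonneg zero_le_one)]; exact min_le_right _ _⟩).continuous).tendsto a
    simpa [Function.comp_def] using this
  refine hc.congr' ?_
  filter_upwards [hc.eventually (gt_mem_nhds (zero_lt_one' ℝ))] with g hg
  rcases min_lt_iff.1 hg with h | h
  · exact min_eq_left h.le
  · exact absurd h (lt_irrefl _)

/-- A proximally continuous map into a pseudometric space is displaced uniformly little by the
small elements of a totally bounded set. -/
theorem ProximallyContinuous.exists_nhds_forall_dist_lt {Y : Type*} [PseudoMetricSpace Y]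
    {f : G → Y} (hf : ProximallyContinuous f) {K : Set G} (hK : TotallyBounded K) {ε : ℝ}
    (hε : 0 < ε) : ∃ V ∈ 𝓝 (1 : G), ∀ v ∈ V, v ∈ K → ∀ g, dist (f g) (f (v * g)) < ε := by
  by_contra! hcon
  have hnhds : ∀ g, {v | dist (f (v * g)) (f g) < ε / 8} ∈ 𝓝 (1 : G) := fun g => by
    have : Tendsto (fun v => f (v * g)) (𝓝 1) (𝓝 (f g)) := by
      have := (hf.continuous_right.comp (continuous_mul_const g)).tendsto 1
      simpa [Function.comp_def] using this
    exact this (Metric.ball_mem_nhds _ (by positivity))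
  -- Pairs (v, g) with v displacing g by at least `ε`, each v chosen so late that it barely moves
  -- the earlier g's.
  obtain ⟨p, hp, hpp⟩ := exists_seq_of_forall_finset_exists
    (fun p : G × G => p.1 ∈ K ∧ ε ≤ dist (f p.2) (f (p.1 * p.2)))
    (fun p q => dist (f (q.1 * p.2)) (f p.2) < ε / 8) (fun s _ => by
      obtain ⟨v, hv, hvK, g, hg⟩ := hcon (⋂ p ∈ s, {v | dist (f (v * p.2)) (f p.2) < ε / 8})
        ((biInter_finset_mem s).2 fun p _ => hnhds p.2)
      exact ⟨(v, g), ⟨hvK, hg⟩, fun p hp => mem_iInter₂.1 hv p hp⟩)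
  obtain ⟨I, hI, hfar⟩ := exists_infinite_forall_le_dist hε fun n => (hp n).2
  set S : Set Y := (fun n => f (p n).2) '' I
  have hSne : S.Nonempty := hI.nonempty.image _
  have huc : UniformContinuous fun y : Y => min (Metric.infDist y S) ε :=
    ((Metric.lipschitz_infDist_pt S).min_const ε).uniformContinuous
  obtain ⟨V, hV, hVf⟩ := uniformContinuous_right_iff.1 (hf _ huc ⟨ε, fun y => by
    rw [abs_of_nonneg (le_min Metric.infDist_nonneg hε.le)]; exact min_le_right _ _⟩)
    (ε / 8) (by positivity)
  obtain ⟨W, hW, hWV⟩ : ∃ W ∈ 𝓝 (1 : G), ∀ v ∈ W, ∀ w ∈ W, v⁻¹ * w ∈ V := by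
    have : Tendsto (fun q : G × G => q.1⁻¹ * q.2) (𝓝 1 ×ˢ 𝓝 1) (𝓝 1) := by
      have := (show Continuous fun q : G × G => q.1⁻¹ * q.2 by fun_prop).tendsto (1, 1)
      rwa [nhds_prod_eq, inv_one, one_mul] at this
    obtain ⟨W, hW, h⟩ := mem_prod_same_iff.1 (this hV)
    exact ⟨W, hW, fun v hv w hw => h (mk_mem_prod hv hw)⟩
  obtain ⟨F, hF, hKF⟩ := hK.exists_finite_right hW
  choose! c hcF hcW using hKF
  -- Pigeonhole gives `n < m` with vₙ vₘ⁻¹ in `V`. Then vₘ gₙ and vₙ gₙ are `V`-close, but f sends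
  -- the former within `ε / 8` of `S` and the latter at least `ε / 4` away from it.
  obtain ⟨n, hn, m, hm, hnm, heq⟩ := hI.exists_lt_map_eq_of_mapsTo
    (f := fun n => c (p n).1) (t := F) (fun n _ => hcF _ (hp n).1) hF
  have hmem : (p n).1 * (p m).1⁻¹ ∈ V := by
    have := hWV _ (hcW _ (hp n).1) _ (heq ▸ hcW _ (hp m).1)
    simpa [mul_assoc] using this
  have hdist := hVf _ hmem ((p m).1 * (p n).2)
  have hnear : Metric.infDist (f ((p m).1 * (p n).2)) S < ε / 8 :=
    (Metric.infDist_le_dist_of_mem (mem_image_of_mem _ hn)).trans_lt (hpp n m hnm)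
  have haway : ε / 4 ≤ Metric.infDist (f ((p n).1 * (p n).2)) S := by
    refine (Metric.le_infDist hSne).2 ?_
    rintro _ ⟨k, hk, rfl⟩
    rw [dist_comm]
    exact hfar k hk n hn
  have hmul : (p n).1 * (p m).1⁻¹ * ((p m).1 * (p n).2) = (p n).1 * (p n).2 := by group
  simp only [Function.comp_apply, hmul, Real.dist_eq] at hdist
  have h1 := (abs_lt.1 hdist).1
  have h2 : ε / 4 ≤ min (Metric.infDist (f ((p n).1 * (p n).2)) S) ε :=
    le_min haway (by linarith)
  have h3 := min_le_left (Metric.infDist (f ((p m).1 * (p n).2)) S) ε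
  linarith

/-- With c a right approximation of b and e a left approximation of a, c e⁻¹ (b a⁻¹)⁻¹ = (c (e⁻¹ a)
c⁻¹)(c b⁻¹). As c ranges over a finite set, e⁻¹ a can be taken small enough for all the conjugates
at once. -/
theorem GroupPrecompact.totallyBounded_div {A : Set G} (hA : GroupPrecompact A) :
    TotallyBounded {x : G | ∃ a ∈ A, ∃ b ∈ A, x = b * a⁻¹} := by
  intro s hs
  obtain ⟨V, hV, hVs⟩ := exists_nhds_one_of_mem_uniformity_right hs
  obtain ⟨W, hW, hWV⟩ := exists_nhds_one_split hV
  obtain ⟨F, hF, hAF⟩ := hA.2.exists_finite_right hW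
  have hconj : (⋂ c ∈ F, {v : G | c * v * c⁻¹ ∈ W}) ∈ 𝓝 (1 : G) := by
    refine (biInter_mem hF).2 fun c _ => ?_
    have := (show Continuous fun v : G => c * v * c⁻¹ by fun_prop).tendsto 1
    exact this (by simpa using hW)
  have hleft : {q : G × G | q.2⁻¹ * q.1 ∈ ⋂ c ∈ F, {v : G | c * v * c⁻¹ ∈ W}} ∈
      @uniformity G (IsTopologicalGroup.leftUniformSpace G) := by
    have := @symm_le_uniformity G (IsTopologicalGroup.leftUniformSpace G)
    exact this (preimage_mem_comap hconj)
  obtain ⟨E, hE, hAE⟩ := hA.1 _ hleft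
  refine ⟨image2 (fun c e => c * e⁻¹) F E, hF.image2 _ hE, ?_⟩
  rintro _ ⟨a, ha, b, hb, rfl⟩
  obtain ⟨c, hc, hcb⟩ := hAF b hb
  obtain ⟨e, he, hea⟩ := mem_iUnion₂.1 (hAE ha)
  refine mem_iUnion₂.2 ⟨c * e⁻¹, mem_image2_of_mem hc he, hVs _ _ ?_⟩
  have := hWV _ (mem_iInter₂.1 hea c hc) _ hcb
  simpa [mul_assoc] using this

end RightUniformity

/-! ### The displacement function and the conclusion -/

/-- The truncated uniform distance between `f` and its left translate by `v`. -/
noncomputable def translationDist {G Y : Type*} [Mul G] [PseudoMetricSpace Y] (f : G → Y) (v : G) :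
    ℝ :=
  ⨆ g, min (dist (f g) (f (v * g))) 1

section TranslationDist

variable {G Y : Type*} [Group G] [PseudoMetricSpace Y] (f : G → Y)

theorem min_dist_le_translationDist (v g : G) :
    min (dist (f g) (f (v * g))) 1 ≤ translationDist f v :=
  le_ciSup (f := fun g => min (dist (f g) (f (v * g))) 1)
    ⟨1, by rintro _ ⟨g, rfl⟩; exact min_le_right _ _⟩ g

theorem translationDist_one : translationDist f 1 = 0 := by
  simp [translationDist]

theorem translationDist_le_add {ε : ℝ} {u v : G}
    (h : ∀ g, dist (f g) (f (v * u⁻¹ * g)) ≤ ε) :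
    translationDist f v ≤ translationDist f u + ε := by
  have hε : 0 ≤ ε := dist_nonneg.trans (h 1)
  refine ciSup_le fun g => ?_
  have h1 := min_dist_le_translationDist f u g
  have h2 := h (u * g)
  rw [show v * u⁻¹ * (u * g) = v * g by group] at h2
  have h3 := dist_triangle (f g) (f (u * g)) (f (v * g))
  rcases min_le_iff.1 h1 with h1 | h1
  · exact (min_le_left _ _).trans (by linarith)
  · exact (min_le_right _ _).trans (by linarith)

end TranslationDist

theorem ProximallyContinuous.uniformContinuous_of_functionallyGenerated {G Y : Type*} [Group G]
    [TopologicalSpace G] [IsTopologicalGroup G]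
    (hG : FunctionallyGenerated {A : Set G | GroupPrecompact A}) [PseudoMetricSpace Y] {f : G → Y}
    (hf : @ProximallyContinuous G Y (IsTopologicalGroup.rightUniformSpace G) _ f) :
    @UniformContinuous G Y (IsTopologicalGroup.rightUniformSpace G) _ f := by
  let _ : UniformSpace G := IsTopologicalGroup.rightUniformSpace G
  have hcont : Continuous (translationDist f) := by
    by_contra hnot
    obtain ⟨A, hA, hext⟩ := hG _ hnot
    refine hext (UniformContinuousOn.exists_continuous_eqOn ?_)
    intro r hr
    obtain ⟨ε, hε, hr⟩ := Metric.mem_uniformity_dist.1 hr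
    obtain ⟨V, hV, hVf⟩ := hf.exists_nhds_forall_dist_lt
      (GroupPrecompact.totallyBounded_div hA) (half_pos hε)
    have hVsymm := mem_uniformity_right_of_nhds_one (inter_mem hV (inv_mem_nhds_one G hV))
    refine mem_map.2 (mem_inf_principal.2 (mem_of_superset hVsymm ?_))
    rintro ⟨a, b⟩ ⟨hab, hab'⟩ ⟨ha, hb⟩
    have hba : a * b⁻¹ ∈ V := by simpa using hab'
    have h1 := translationDist_le_add f fun g => (hVf _ hab ⟨a, ha, b, hb, rfl⟩ g).le
    have h2 := translationDist_le_add f fun g => (hVf _ hba ⟨b, hb, a, ha, rfl⟩ g).le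
    refine hr ?_
    rw [Real.dist_eq, abs_lt]
    constructor <;> linarith
  refine uniformContinuous_right_iff.2 fun ε hε => ?_
  have htendsto := hcont.tendsto 1
  rw [translationDist_one] at htendsto
  refine ⟨_, htendsto (gt_mem_nhds (lt_min hε one_pos)), fun v hv g => ?_⟩
  have h := (min_dist_le_translationDist f v g).trans_lt hv
  rcases min_lt_iff.1 h with h | h
  · exact h.trans_le (min_le_left _ _)
  · exact absurd (h.trans_le (min_le_right _ _)) (lt_irrefl _)

theorem corollary2p6 (G : Type u) [Group G] [TopologicalSpace G] [IsTopologicalGroup G]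
    (hG : FunctionallyGenerated {A : Set G | GroupPrecompact A}) :
    ProximallyFineGroup.{u, v} G := by
  intro Y uY f hf s hs
  -- A coarser uniformity on `Y` has fewer test functions, so `f` stays proximally continuous, and
  -- `s` is still an entourage.
  obtain ⟨d, hd, hmem⟩ := exists_pseudoMetricSpace_le_of_mem_uniformity (fun _ => s) fun _ => hs
  have hfd : @ProximallyContinuous G Y (IsTopologicalGroup.rightUniformSpace G)
      d.toUniformSpace f :=
    fun φ hφ hb => hf φ (le_trans (map_mono hd) hφ) hb
  exact ProximallyContinuous.uniformContinuous_of_functionallyGenerated hG hfd (hmem 0)
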